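/- Let $\mathbb K$ be a field, let $n \ge 0$, let $a_1,\dots,a_n$ be positive integers, and let $A=(x_{i_1,\dots,i_n})_{1\le i_j\le a_j}$ be the generic $a_1\times\dots\times a_n$ table, whose entries are the variables of the polynomial ring $R=\mathbb K[x_{i_1,\dots,i_n}]$. For $\mathcal J\subseteq\{1,\dots,n\}$ the marginal table $A_{\mathcal J}$ is the table indexed by $(i_j)_{j\in\mathcal J}$ whose entry at $(i_j)_{j\in\mathcal J}$ is the sum of all entries of $A$ whose indices at the positions $j\in\mathcal J$ are the given $i_j$. For a table $B=(b_{i})$ with entries in $R$, indexed by tuples $i=(i_j)_{j \in \mathcal J}$, let $I(B)\subseteq R$ be the ideal generated by the generalized $2\times 2$ minors $$\det\begin{pmatrix} b_{i} & b_{k'}\\ b_{i'} & b_{k}\end{pmatrix},$$ for all index tuples $i,k$ and all coordinates $l \in \mathcal J$, where $i'$ is $i$ with its $l$-th coordinate replaced by $k_l$, and $k'$ is $k$ with its $l$-th coordinate replaced by $i_l$. For a collection $\Delta$ of subsets of $\{1,\dots,n\}$, let $$I_\Delta(A)=\sum_{\mathcal J\in\Delta} I(A_{\mathcal J})\subseteq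 R .$$ Theorem. If $\Delta$ is a simplicial complex (a collection of subsets of $\{1,\dots,n\}$ closed under taking subsets) with at most three facets (inclusion-maximal elements), then $I_\Delta(A)$ is a radical ideal. -/

import Mathlib

/-- The marginal table `A_J` of a table `A`: its entry at `s` is the sum of all entries of `A`
whose indices in `J` are prescribed by `s`. -/
def marginalTable {R : Type*} [CommRing R] {n : ℕ} {a : Fin n → ℕ}
    (A : ((j : Fin n) → Fin (a j)) → R) (J : Finset (Fin n)) :
    ((j : J) → Fin (a j)) → R :=
  fun s => ∑ i : (j : Fin n) → Fin (a j) with (∀ j : J, i j = s j), A i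

/-- The generalized `2 × 2` minor of the table `B` about the coordinate `l`, attached to the two
indices `i` and `k`: only the `l`-th coordinates of `i` and `k` are interchanged. -/
def tableMinor {R : Type*} [CommRing R] {ι : Type*} [DecidableEq ι] {b : ι → ℕ}
    (B : ((j : ι) → Fin (b j)) → R) (l : ι) (i k : (j : ι) → Fin (b j)) : R :=
  Matrix.det !![B i, B (Function.update k l (i l));
                B (Function.update i l (k l)), B k]

/-- The ideal `I(B)` generated by all generalized `2 × 2` minors of the table `B`. -/
def segreIdeal {R : Type*} [CommRing R] {ι : Type*} [DecidableEq ι] {b : ι → ℕ}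
    (B : ((j : ι) → Fin (b j)) → R) : Ideal R :=
  Ideal.span {f | ∃ (l : ι) (i k : (j : ι) → Fin (b j)), f = tableMinor B l i k}

/-- The `Δ`-independence ideal `I_Δ(A) = ∑_{J ∈ Δ} I(A_J)`. -/
def independenceIdeal {R : Type*} [CommRing R] {n : ℕ} {a : Fin n → ℕ}
    (Δ : Set (Finset (Fin n))) (A : ((j : Fin n) → Fin (a j)) → R) : Ideal R :=
  ⨆ J ∈ Δ, segreIdeal (marginalTable A J)

/-- The generic `a₁ × ⋯ × aₙ` table over `K`: its entries are distinct variables. -/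
noncomputable def genericTable (K : Type*) [Field K] {n : ℕ} (a : Fin n → ℕ) :
    ((j : Fin n) → Fin (a j)) → MvPolynomial ((j : Fin n) → Fin (a j)) K :=
  fun i => MvPolynomial.X i

/-- The facets of `Δ`: its maximal faces. -/
def facets {n : ℕ} (Δ : Set (Finset (Fin n))) : Set (Finset (Fin n)) :=
  {J | Maximal (fun F => F ∈ Δ) J}

/-! Number each index range from 0 and let the value 0 in a coordinate mean "summed over". This is
an invertible linear change of variables (`marginEquiv`). It makes the margins independent variables
and turns the ideal into a binomial ideal (`independenceIdeal_eq_map_swapIdeal`). The generators say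
that two indices vanishing outside a common face may interchange one coordinate. Only the facets
matter.

The quotient by such an ideal is the monoid algebra of multisets of indices modulo swaps. It is
reduced once n • s ~ n • t implies s ~ t for n ≠ 0
(`AddMonoidAlgebra.isReduced_of_nsmul_injective`), so the rest is combinatorics.

Swaps preserve the multiset of values in each coordinate, and these margins are torsion-free.
Suppose every element lies in some facet. If s can be swapped to contain an "agent", an element
supported in all facets, then the margins determine its class among multisets with an agent
(`HasAgent.swapRel`). If it cannot, then for at most three facets s splits into parts governed by
fewer facets that never interact, even after passing to multiples, and torsion-freeness is inherited
from the parts (`SwapTorsionFreeAt.add`, `swapTorsionFreeAt_triple`). -/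

/-! ### Reducedness of monoid algebras. -/

lemma Int.isJacobsonRing : IsJacobsonRing ℤ := by
  rw [isJacobsonRing_iff_prime_eq]
  intro P hP
  rcases eq_or_ne P ⊥ with rfl | h
  · rw [eq_bot_iff]
    intro x hx
    rw [Ideal.mem_jacobson_bot] at hx
    -- Membership in the Jacobson radical makes x * x + 1 a unit, which forces x = 0.
    have := Int.isUnit_iff.1 (hx x)
    rw [Ideal.mem_bot]
    rcases this with h | h <;> nlinarith [mul_self_nonneg x]
  · exact Ideal.jacobson_eq_self_of_isMaximal (H := hP.isMaximal h)

/-- Nullstellensatz over ℤ: in characteristic zero the field would be a finite extension of ℤ, and ℤ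
would itself be a field. -/
lemma charP_of_finiteType_int {A F : Type*} [CommRing A] [Algebra.FiniteType ℤ A] [Field F]
    (f : A →+* F) (hf : Function.Surjective f) : ∃ p, p.Prime ∧ CharP F p := by
  have : Algebra.FiniteType ℤ F := Algebra.FiniteType.of_surjective f.toIntAlgHom hf
  have := Int.isJacobsonRing
  obtain ⟨p, hp⟩ := CharP.exists F
  rcases CharP.char_is_prime_or_zero F p with h | rfl
  · exact ⟨p, h, hp⟩
  · exfalso
    have : CharZero F := CharP.charP_to_charZero F
    have : Module.Finite ℤ F := finite_of_finite_type_of_isJacobsonRing ℤ F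
    exact Int.not_isField (isField_of_isIntegral_of_isField
      (FaithfulSMul.algebraMap_injective ℤ F) (Field.toIsField F))

/-- Frobenius is additive and multiplies exponents by p. These stay distinct, so no terms of the
p-th power can cancel. -/
lemma AddMonoidAlgebra.eq_zero_of_pow_char_eq_zero {K M : Type*} [Field K] [AddCommMonoid M]
    {p : ℕ} (hp : p.Prime) [CharP K p] (hM : Function.Injective fun a : M => p • a)
    (f : AddMonoidAlgebra K M) (hf : f ^ p = 0) : f = 0 := by
  have : Fact p.Prime := ⟨hp⟩
  have : CharP (AddMonoidAlgebra K M) p :=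
    charP_of_injective_algebraMap (FaithfulSMul.algebraMap_injective K _) p
  have e : f = ∑ m ∈ f.coeff.support, AddMonoidAlgebra.single m (f.coeff m) := by
    rw [← AddMonoidAlgebra.coeff_inj, AddMonoidAlgebra.coeff_sum]
    exact (Finsupp.sum_single f.coeff).symm
  have h : f ^ p = ∑ m ∈ f.coeff.support, AddMonoidAlgebra.single (p • m) (f.coeff m ^ p) := by
    conv_lhs => rw [e]
    rw [sum_pow_char]
    simp [AddMonoidAlgebra.single_pow]
  rw [← AddMonoidAlgebra.coeff_eq_zero]
  ext m
  by_contra hm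
  have := congrArg (fun g => g.coeff (p • m)) (h.symm.trans hf)
  simp only [AddMonoidAlgebra.coeff_sum, AddMonoidAlgebra.coeff_single, Finsupp.finsetSum_apply,
    AddMonoidAlgebra.coeff_zero, Finsupp.coe_zero, Pi.zero_apply] at this
  rw [Finset.sum_eq_single m] at this
  · simp only [Finsupp.single_eq_same] at this
    exact hm (by simpa using pow_eq_zero_iff hp.ne_zero |>.1 this)
  · intro b _ hb
    rw [Finsupp.single_eq_of_ne]
    exact fun h => hb (hM h.symm)
  · intro h
    exact absurd (Finsupp.mem_support_iff.2 (by simpa using hm)) h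

lemma AddMonoidAlgebra.eq_zero_of_pow_eq_zero_of_charP {K M : Type*} [Field K] [AddCommMonoid M]
    {p : ℕ} (hp : p.Prime) [CharP K p] (hM : Function.Injective fun a : M => p • a)
    (f : AddMonoidAlgebra K M) (hf : IsNilpotent f) : f = 0 := by
  obtain ⟨n, hn⟩ := hf
  have key : ∀ k, f ^ p ^ k = 0 → f = 0 := by
    intro k
    induction k with
    | zero => simp
    | succ k ih =>
      intro h
      rw [pow_succ, pow_mul] at h
      exact ih (eq_zero_of_pow_char_eq_zero hp hM _ h)
  exact key n (pow_eq_zero_of_le (Nat.lt_pow_self hp.one_lt).le hn)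

/-- The monoid algebra of a commutative monoid without torsion is reduced. -/
lemma AddMonoidAlgebra.isReduced_of_nsmul_injective {K M : Type*} [Field K] [AddCommMonoid M]
    (hM : ∀ n : ℕ, n ≠ 0 → Function.Injective fun a : M => n • a) :
    IsReduced (AddMonoidAlgebra K M) := by
  refine ⟨fun f hf => ?_⟩
  by_contra h0
  obtain ⟨m, hm⟩ : ∃ m, f.coeff m ≠ 0 := by
    by_contra! h
    exact h0 (AddMonoidAlgebra.coeff_eq_zero.1 (Finsupp.ext h))
  set c := f.coeff m
  -- Spreading out: f is defined over a finitely generated ring in which its coefficient c is a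
  -- unit. Hence c survives in every residue field, all of which have positive characteristic.
  let A : Subalgebra ℤ K :=
    Algebra.adjoin ℤ (insert c⁻¹ (f.coeff '' (f.coeff.support : Set M)))
  have hfin : (insert c⁻¹ (f.coeff '' (f.coeff.support : Set M))).Finite :=
    (f.coeff.support.finite_toSet.image _).insert _
  have : Algebra.FiniteType ℤ A := by
    rw [← Subalgebra.fg_iff_finiteType]
    exact Subalgebra.fg_def.2 ⟨_, hfin, rfl⟩
  have hcoeff : ∀ x, f.coeff x ∈ A := by
    intro x
    by_cases hx : f.coeff x = 0
    · rw [hx]; exact A.zero_mem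
    · exact Algebra.subset_adjoin (.inr ⟨x, by simpa using hx, rfl⟩)
  have hcinv : c⁻¹ ∈ A := Algebra.subset_adjoin (Set.mem_insert _ _)
  obtain ⟨g, hg⟩ : ∃ g : AddMonoidAlgebra A M,
      AddMonoidAlgebra.mapRingHom M (A.val : A →+* K) g = f := by
    refine ⟨∑ x ∈ f.coeff.support, AddMonoidAlgebra.single x ⟨f.coeff x, hcoeff x⟩, ?_⟩
    rw [← AddMonoidAlgebra.coeff_inj]
    simp only [map_sum, AddMonoidAlgebra.mapRingHom_single, AddMonoidAlgebra.coeff_sum,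
      AddMonoidAlgebra.coeff_single]
    exact Finsupp.sum_single f.coeff
  have hinj : Function.Injective (AddMonoidAlgebra.mapRingHom M (A.val : A →+* K)) := by
    rw [injective_iff_map_eq_zero]
    intro a ha
    rw [← AddMonoidAlgebra.coeff_eq_zero]
    ext x
    have := congrArg (fun g => g.coeff x) ha
    simpa using this
  have hgn : IsNilpotent g := by
    rw [← IsNilpotent.map_iff hinj, hg]; exact hf
  obtain ⟨I, hI⟩ := Ideal.exists_maximal A
  let : Field (A ⧸ I) := Ideal.Quotient.field I
  obtain ⟨p, hp, hchar⟩ := charP_of_finiteType_int (Ideal.Quotient.mk I)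
    Ideal.Quotient.mk_surjective
  have hz := AddMonoidAlgebra.eq_zero_of_pow_eq_zero_of_charP hp (hM p hp.ne_zero) _
    (hgn.map (AddMonoidAlgebra.mapRingHom M (Ideal.Quotient.mk I)))
  have hgm : g.coeff m ∈ I := by
    have := congrArg (fun g => g.coeff m) hz
    simpa [Ideal.Quotient.eq_zero_iff_mem] using this
  have hgc : ((g.coeff m : A) : K) = c := by
    have := congrArg (fun g => g.coeff m) hg
    simpa using this
  refine hI.ne_top (Ideal.eq_top_of_isUnit_mem _ hgm ?_)
  refine IsUnit.of_mul_eq_one ⟨c⁻¹, hcinv⟩ (Subtype.ext ?_)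
  simp [hgc, hm]

/-! ### Swap equivalence of multisets of indices -/

/-- `x` vanishes outside `F`. -/
def SupportedIn {ι : Type*} {V : ι → Type*} [∀ j, Zero (V j)] (F : Finset ι)
    (x : (j : ι) → V j) : Prop :=
  ∀ j, j ∉ F → x j = 0

/-- One swap: the `l`-th coordinates of two elements supported in a common member of `𝓕` are
interchanged. -/
inductive SwapStep {ι : Type*} [DecidableEq ι] {V : ι → Type*} [∀ j, Zero (V j)]
    (𝓕 : Set (Finset ι)) : Multiset ((j : ι) → V j) → Multiset ((j : ι) → V j) → Prop
  | swap (F : Finset ι) (hF : F ∈ 𝓕) (x y : (j : ι) → V j) (hx : SupportedIn F x)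
      (hy : SupportedIn F y) (l : ι) (r : Multiset ((j : ι) → V j)) :
      SwapStep 𝓕 (x ::ₘ y ::ₘ r)
        (Function.update x l (y l) ::ₘ Function.update y l (x l) ::ₘ r)

/-- The equivalence relation generated by swaps. -/
def SwapRel {ι : Type*} [DecidableEq ι] {V : ι → Type*} [∀ j, Zero (V j)]
    (𝓕 : Set (Finset ι)) : Multiset ((j : ι) → V j) → Multiset ((j : ι) → V j) → Prop :=
  Relation.ReflTransGen (SwapStep 𝓕)

/-- `s` and `t` have the same size and the same multisets of coordinates. -/
def SameMargins {ι : Type*} {V : ι → Type*} (s t : Multiset ((j : ι) → V j)) : Prop :=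
  s.card = t.card ∧ ∀ j, s.map (· j) = t.map (· j)

lemma SameMargins.symm {ι : Type*} {V : ι → Type*} {s t : Multiset ((j : ι) → V j)}
    (h : SameMargins s t) : SameMargins t s :=
  ⟨h.1.symm, fun j => (h.2 j).symm⟩

lemma SupportedIn.mono {ι : Type*} {V : ι → Type*} [∀ j, Zero (V j)] {F G : Finset ι}
    (h : F ⊆ G) {x : (j : ι) → V j} (hx : SupportedIn F x) : SupportedIn G x :=
  fun j hj => hx j fun hF => hj (h hF)

section Swap

variable {ι : Type*} [DecidableEq ι] {V : ι → Type*} [∀ j, Zero (V j)]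
  {𝓕 𝓖 : Set (Finset ι)} {s s' t u v w : Multiset ((j : ι) → V j)}

lemma SupportedIn.update {F : Finset ι} {x y : (j : ι) → V j} (hx : SupportedIn F x)
    (hy : SupportedIn F y) (l : ι) : SupportedIn F (Function.update x l (y l)) := by
  intro j hj
  by_cases h : j = l
  · subst h; simpa using hy j hj
  · simpa [h] using hx j hj

lemma SupportedIn.update_of_mem {F : Finset ι} {x : (j : ι) → V j} (hx : SupportedIn F x)
    {l : ι} (hl : l ∈ F) (c : V l) : SupportedIn F (Function.update x l c) := by
  intro j hj
  have h : j ≠ l := by rintro rfl; exact hj hl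
  simpa [h] using hx j hj

lemma SwapStep.symm (h : SwapStep 𝓕 s t) : SwapStep 𝓕 t s := by
  obtain ⟨F, hF, x, y, hx, hy, l, r⟩ := h
  have := SwapStep.swap F hF _ _ (hx.update hy l) (hy.update hx l) l r
  simpa using this

lemma SwapStep.add_right (h : SwapStep 𝓕 s t) (r : Multiset ((j : ι) → V j)) :
    SwapStep 𝓕 (s + r) (t + r) := by
  obtain ⟨F, hF, x, y, hx, hy, l, q⟩ := h
  simpa using SwapStep.swap F hF x y hx hy l (q + r)

lemma SwapStep.mono (hfg : 𝓕 ⊆ 𝓖) (h : SwapStep 𝓕 s t) : SwapStep 𝓖 s t := by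
  obtain ⟨F, hF, x, y, hx, hy, l, q⟩ := h
  exact .swap F (hfg hF) x y hx hy l q

namespace SwapRel

lemma refl (s : Multiset ((j : ι) → V j)) : SwapRel 𝓕 s s := Relation.ReflTransGen.refl

lemma trans (h : SwapRel 𝓕 s t) (h' : SwapRel 𝓕 t u) : SwapRel 𝓕 s u :=
  Relation.ReflTransGen.trans h h'

lemma symm (h : SwapRel 𝓕 s t) : SwapRel 𝓕 t s := by
  induction h with
  | refl => exact refl _
  | tail _ h ih => exact Relation.ReflTransGen.head h.symm ih

lemma mono (hfg : 𝓕 ⊆ 𝓖) (h : SwapRel 𝓕 s t) : SwapRel 𝓖 s t := by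
  induction h with
  | refl => exact refl _
  | tail _ h ih => exact ih.tail (h.mono hfg)

lemma add_right (h : SwapRel 𝓕 s t) (r : Multiset ((j : ι) → V j)) :
    SwapRel 𝓕 (s + r) (t + r) := by
  induction h with
  | refl => exact refl _
  | tail _ h ih => exact ih.tail (h.add_right r)

lemma add (h : SwapRel 𝓕 s t) (h' : SwapRel 𝓕 u v) : SwapRel 𝓕 (s + u) (t + v) := by
  refine (h.add_right u).trans ?_
  rw [add_comm t u, add_comm t v]
  exact h'.add_right t

lemma cons (x : (j : ι) → V j) (h : SwapRel 𝓕 s t) : SwapRel 𝓕 (x ::ₘ s) (x ::ₘ t) := by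
  simpa only [Multiset.singleton_add] using (refl {x}).add h

lemma nsmul (n : ℕ) (h : SwapRel 𝓕 s t) : SwapRel 𝓕 (n • s) (n • t) := by
  induction n with
  | zero => simpa using refl _
  | succ n ih => rw [succ_nsmul, succ_nsmul]; exact ih.add h

lemma swap {F : Finset ι} (hF : F ∈ 𝓕) {x y : (j : ι) → V j} (hx : SupportedIn F x)
    (hy : SupportedIn F y) (l : ι) (r : Multiset ((j : ι) → V j)) :
    SwapRel 𝓕 (x ::ₘ y ::ₘ r)
      (Function.update x l (y l) ::ₘ Function.update y l (x l) ::ₘ r) :=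
  Relation.ReflTransGen.single (.swap F hF x y hx hy l r)

lemma eq_of_empty (h : SwapRel (∅ : Set (Finset ι)) s t) : s = t := by
  induction h with
  | refl => rfl
  | tail _ h _ => obtain ⟨F, hF, _⟩ := h; exact absurd hF (Set.notMem_empty F)

lemma map_eval (h : SwapRel 𝓕 s t) (j : ι) : s.map (· j) = t.map (· j) := by
  induction h with
  | refl => rfl
  | tail _ h ih =>
    rw [ih]
    obtain ⟨F, hF, x, y, hx, hy, l, q⟩ := h
    by_cases hj : j = l
    · subst hj; simp [Multiset.cons_swap]
    · simp [hj]

lemma card_eq (h : SwapRel 𝓕 s t) : s.card = t.card := by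
  induction h with
  | refl => rfl
  | tail _ h ih => rw [ih]; obtain ⟨F, hF, x, y, hx, hy, l, q⟩ := h; simp

lemma supportedIn (h : SwapRel 𝓕 s t) (hs : ∀ x ∈ s, ∃ F ∈ 𝓖, SupportedIn F x)
    (hfg : 𝓕 ⊆ 𝓖) : ∀ x ∈ t, ∃ F ∈ 𝓖, SupportedIn F x := by
  induction h with
  | refl => exact hs
  | tail _ h ih =>
    obtain ⟨F, hF, x, y, hx, hy, l, q⟩ := h
    intro z hz
    simp only [Multiset.mem_cons] at hz ih
    rcases hz with rfl | rfl | hz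
    · exact ⟨F, hfg hF, hx.update hy l⟩
    · exact ⟨F, hfg hF, hy.update hx l⟩
    · exact ih z (.inr (.inr hz))

end SwapRel

end Swap

/-! ### Agents: elements supported in every member of the family. -/

section Agent

variable {ι : Type*} [DecidableEq ι] {V : ι → Type*} [∀ j, Zero (V j)]
  {𝓕 : Set (Finset ι)} {s s' r : Multiset ((j : ι) → V j)} {t x y z : (j : ι) → V j}

/-- An element supported in all members of `𝓕` can be swapped into any element of that kind whose
coordinates occur. -/
lemma SwapRel.exists_cons [Finite ι] (ht : ∀ F ∈ 𝓕, SupportedIn F t)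
    (hx : ∀ F ∈ 𝓕, SupportedIn F x) (hs : ∀ z ∈ s, ∃ F ∈ 𝓕, SupportedIn F z)
    (hocc : ∀ j, ∃ z ∈ t ::ₘ s, z j = x j) : ∃ r, SwapRel 𝓕 (t ::ₘ s) (x ::ₘ r) := by
  have key : ∀ A : Finset ι, ∃ t' r, SwapRel 𝓕 (t ::ₘ s) (t' ::ₘ r) ∧
      (∀ F ∈ 𝓕, SupportedIn F t') ∧ (∀ z ∈ r, ∃ F ∈ 𝓕, SupportedIn F z) ∧
      ∀ j ∈ A, t' j = x j := by
    intro A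
    induction A using Finset.induction_on with
    | empty => exact ⟨t, s, .refl _, ht, hs, by simp⟩
    | insert l A hl ih =>
      obtain ⟨t', r, h, ht', hr, hA⟩ := ih
      -- Swaps preserve margins, so the wanted value is still held by some element. As t' is
      -- supported in every member, it can swap with that element.
      have hmem : x l ∈ (t' ::ₘ r).map (· l) := by
        rw [← h.map_eval l]; exact Multiset.mem_map.2 (hocc l)
      obtain ⟨z, hz, hzl⟩ := Multiset.mem_map.1 hmem
      rcases Multiset.mem_cons.1 hz with rfl | hz
      · refine ⟨z, r, h, ht', hr, fun j hj => ?_⟩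
        rcases Finset.mem_insert.1 hj with rfl | hj
        · exact hzl
        · exact hA j hj
      · obtain ⟨F, hF, hzF⟩ := hr z hz
        obtain ⟨q, rfl⟩ := Multiset.exists_cons_of_mem hz
        refine ⟨_, _, h.trans (.swap hF (ht' F hF) hzF l q), ?_, ?_, ?_⟩
        · intro G hG
          rw [hzl]
          exact (ht' G hG).update (hx G hG) l
        · intro w hw
          rcases Multiset.mem_cons.1 hw with rfl | hw
          · exact ⟨F, hF, hzF.update (ht' F hF) l⟩
          · exact hr w (Multiset.mem_cons_of_mem hw)
        · intro j hj
          by_cases hjl : j = l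
          · subst hjl; simpa using hzl
          · simpa [hjl] using hA j ((Finset.mem_insert.1 hj).resolve_left hjl)
  cases nonempty_fintype ι
  obtain ⟨t', r, h, -, -, hA⟩ := key Finset.univ
  obtain rfl : t' = x := funext fun j => hA j (Finset.mem_univ j)
  exact ⟨r, h⟩

/-- In the presence of an element `t` supported in all members of `𝓕`, two elements supported in
different members can swap common coordinates. -/
lemma SwapRel.swap_of_agent (ht : ∀ F ∈ 𝓕, SupportedIn F t) {F G : Finset ι} (hF : F ∈ 𝓕)
    (hG : G ∈ 𝓕) (hy : SupportedIn F y) (hz : SupportedIn G z) {l : ι} (hlF : l ∈ F) (hlG : l ∈ G)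
    (r : Multiset ((j : ι) → V j)) :
    SwapRel 𝓕 (t ::ₘ y ::ₘ z ::ₘ r)
      (t ::ₘ Function.update y l (z l) ::ₘ Function.update z l (y l) ::ₘ r) := by
  -- The agent takes the value of z, trades it with y, hands the value of y to z, and gets its own
  -- value back.
  have h1 := SwapRel.swap hG (ht G hG) hz l (y ::ₘ r)
  have h2 := SwapRel.swap hF ((ht F hF).update_of_mem hlF (z l)) hy l
    (Function.update z l (t l) ::ₘ r)
  have h3 := SwapRel.swap hG ((ht G hG).update_of_mem hlG (y l))
    (hz.update_of_mem hlG (t l)) l (Function.update y l (z l) ::ₘ r)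
  simp only [Function.update_self, Function.update_idem, Function.update_eq_self] at h1 h2 h3
  rw [Multiset.cons_swap z] at h1
  rw [Multiset.cons_swap y] at h2
  rw [Multiset.cons_swap (Function.update z l (t l)), Multiset.cons_swap
    (Function.update z l (y l))] at h3
  exact h1.trans (h2.trans h3)

/-- This lets two multisets with equal margins be brought to share the element x, which can then be
cancelled. The last hypothesis handles a needed value held only by an element whose support excludes
that coordinate. -/
lemma SwapRel.exists_cons_cons_of_agent [Finite ι] (ht : ∀ F ∈ 𝓕, SupportedIn F t) {F : Finset ι}
    (hF : F ∈ 𝓕) (hy : SupportedIn F y) (hx : SupportedIn F x)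
    (hr : ∀ z ∈ r, ∃ F ∈ 𝓕, SupportedIn F z)
    (hocc : ∀ j ∈ F, ∃ z ∈ y ::ₘ r, z j = x j)
    (hzero : ∀ j ∈ F, x j = 0 → ∀ z ∈ y ::ₘ r, z j = 0) :
    ∃ q, SwapRel 𝓕 (t ::ₘ y ::ₘ r) (t ::ₘ x ::ₘ q) ∧ ∀ z ∈ q, ∃ F ∈ 𝓕, SupportedIn F z := by
  have key : ∀ A : Finset ι, ∃ y' q, SwapRel 𝓕 (t ::ₘ y ::ₘ r) (t ::ₘ y' ::ₘ q) ∧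
      SupportedIn F y' ∧ (∀ z ∈ q, ∃ F ∈ 𝓕, SupportedIn F z) ∧ ∀ j ∈ A, y' j = x j := by
    intro A
    induction A using Finset.induction_on with
    | empty => exact ⟨y, r, .refl _, hy, hr, by simp⟩
    | insert l A hl ih =>
      obtain ⟨y', q, h, hy', hq, hA⟩ := ih
      have done : y' l = x l → ∀ j ∈ insert l A, y' j = x j := by
        intro h j hj
        rcases Finset.mem_insert.1 hj with rfl | hj
        · exact h
        · exact hA j hj
      by_cases hlF : l ∈ F
      swap
      · exact ⟨y', q, h, hy', hq, done (by rw [hy' l hlF, hx l hlF])⟩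
      have hmap : (y ::ₘ r).map (· l) = (y' ::ₘ q).map (· l) := by
        simpa using h.map_eval l
      have hmem : x l ∈ (y' ::ₘ q).map (· l) := by
        rw [← hmap]; exact Multiset.mem_map.2 (hocc l hlF)
      obtain ⟨z, hz, hzl⟩ := Multiset.mem_map.1 hmem
      rcases Multiset.mem_cons.1 hz with rfl | hz
      · exact ⟨z, q, h, hy', hq, done hzl⟩
      obtain ⟨G, hG, hzG⟩ := hq z hz
      by_cases hlG : l ∈ G
      · obtain ⟨q, rfl⟩ := Multiset.exists_cons_of_mem hz
        refine ⟨_, _, h.trans (.swap_of_agent ht hF hG hy' hzG hlF hlG q), ?_, ?_, ?_⟩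
        · exact hy'.update_of_mem hlF _
        · intro w hw
          rcases Multiset.mem_cons.1 hw with rfl | hw
          · exact ⟨G, hG, hzG.update_of_mem hlG _⟩
          · exact hq w (Multiset.mem_cons_of_mem hw)
        · intro j hj
          by_cases hjl : j = l
          · subst hjl; simpa using hzl
          · simpa [hjl] using hA j ((Finset.mem_insert.1 hj).resolve_left hjl)
      -- Here the agent cannot mediate, but the value is 0, so the whole margin at l is 0 and
      -- nothing has to move.
      · have hx0 : x l = 0 := by rw [← hzl]; exact hzG l hlG
        have : y' l ∈ (y ::ₘ r).map (· l) := by rw [hmap]; simp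
        obtain ⟨w, hw, hwl⟩ := Multiset.mem_map.1 this
        refine ⟨y', q, h, hy', hq, done ?_⟩
        rw [hx0, ← hzero l hlF hx0 w hw, hwl]
  cases nonempty_fintype ι
  obtain ⟨y', q, h, -, hq, hA⟩ := key Finset.univ
  obtain rfl : y' = x := funext fun j => hA j (Finset.mem_univ j)
  exact ⟨q, h, hq⟩

/-- Outside G the element y contributes zeros to the margins of s', hence to those of s. Swaps
inside F collect these zeros in one element. -/
lemma SwapRel.exists_cons_of_sameMargins [Finite ι] {F G : Finset ι} (hF : F ∈ 𝓕)
    (hs : ∀ z ∈ s, SupportedIn F z) (h : SameMargins s s') (hy : y ∈ s')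
    (hyG : SupportedIn G y) :
    ∃ x r, SwapRel 𝓕 s (x ::ₘ r) ∧ SupportedIn F x ∧ SupportedIn G x := by
  have hpos : 0 < s.card := by rw [h.1]; exact Multiset.card_pos_iff_exists_mem.2 ⟨y, hy⟩
  obtain ⟨z, hz⟩ := Multiset.card_pos_iff_exists_mem.1 hpos
  obtain ⟨r, rfl⟩ := Multiset.exists_cons_of_mem hz
  have hxF : SupportedIn F fun j => if j ∈ G then z j else 0 := by
    intro j hj
    simp [hs z hz j hj]
  have hxG : SupportedIn G fun j => if j ∈ G then z j else 0 := by
    intro j hj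
    simp [hj]
  obtain ⟨q, hq⟩ := SwapRel.exists_cons (𝓕 := {F}) (t := z) (s := r) (by simpa using hs z hz)
    (by simpa using hxF) (fun w hw => ⟨F, rfl, hs w (Multiset.mem_cons_of_mem hw)⟩) (fun j => by
      by_cases hj : j ∈ G
      · exact ⟨z, hz, by simp [hj]⟩
      · have : (0 : V j) ∈ (z ::ₘ r).map (· j) := by
          rw [h.2 j]; exact Multiset.mem_map.2 ⟨y, hy, hyG j hj⟩
        simpa [hj] using Multiset.mem_map.1 this)
  exact ⟨_, q, hq.mono (by simpa using hF), hxF, hxG⟩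

lemma SwapRel.exists_common_support [Finite ι] {F₁ F₂ F₃ : Finset ι}
    (h𝓕 : 𝓕 = {F₁, F₂, F₃}) (hs : ∀ z ∈ s, ∃ F ∈ 𝓕, SupportedIn F z)
    (hs' : ∀ z ∈ s', ∃ F ∈ 𝓕, SupportedIn F z) (h : SameMargins s s') (h0 : s ≠ 0) :
    ∃ F ∈ 𝓕, ∃ y r y' r', SwapRel 𝓕 s (y ::ₘ r) ∧ SwapRel 𝓕 s' (y' ::ₘ r') ∧
      SupportedIn F y ∧ SupportedIn F y' := by
  obtain ⟨y, hy⟩ := Multiset.exists_mem_of_ne_zero h0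
  have h0' : s' ≠ 0 := by rw [← Multiset.card_pos, ← h.1]; exact Multiset.card_pos.2 h0
  obtain ⟨y', hy'⟩ := Multiset.exists_mem_of_ne_zero h0'
  obtain ⟨F, hF, hyF⟩ := hs y hy
  obtain ⟨G, hG, hyG⟩ := hs' y' hy'
  by_cases hc : ∃ F ∈ 𝓕, ∃ y ∈ s, ∃ y' ∈ s', SupportedIn F y ∧ SupportedIn F y'
  · obtain ⟨F, hF, y, hy, y', hy', hyF, hyF'⟩ := hc
    obtain ⟨r, rfl⟩ := Multiset.exists_cons_of_mem hy
    obtain ⟨r', rfl⟩ := Multiset.exists_cons_of_mem hy'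
    exact ⟨F, hF, y, r, y', r', .refl _, .refl _, hyF, hyF'⟩
  push Not at hc
  -- The only use of the bound three: s and s' use disjoint sets of members, and if each needed two
  -- there would be four.
  have hor : (∀ z ∈ s, SupportedIn F z) ∨ ∀ z ∈ s', SupportedIn G z := by
    by_contra! hne
    obtain ⟨⟨z, hz, hzF⟩, z', hz', hzG⟩ := hne
    obtain ⟨H, hH, hzH⟩ := hs z hz
    obtain ⟨H', hH', hzH'⟩ := hs' z' hz'
    have e1 : F ≠ G := by rintro rfl; exact hc F hF y hy y' hy' hyF hyG
    have e2 : H ≠ G := by rintro rfl; exact hc H hG z hz y' hy' hzH hyG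
    have e3 : F ≠ H' := by rintro rfl; exact hc F hF y hy z' hz' hyF hzH'
    have e4 : H ≠ H' := by rintro rfl; exact hc H hH z hz z' hz' hzH hzH'
    have e5 : H ≠ F := by rintro rfl; exact hzF hzH
    have e6 : H' ≠ G := by rintro rfl; exact hzG hzH'
    rw [h𝓕] at hF hG hH hH'
    simp only [Set.mem_insert_iff, Set.mem_singleton_iff] at hF hG hH hH'
    grind
  rcases hor with hor | hor
  · obtain ⟨x, r, hr, hxF, hxG⟩ := SwapRel.exists_cons_of_sameMargins hF hor h hy' hyG
    obtain ⟨r', rfl⟩ := Multiset.exists_cons_of_mem hy'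
    exact ⟨G, hG, x, r, y', r', hr, .refl _, hxG, hyG⟩
  · obtain ⟨x, r, hr, hxG, hxF⟩ := SwapRel.exists_cons_of_sameMargins hG hor h.symm hy hyF
    obtain ⟨r', rfl⟩ := Multiset.exists_cons_of_mem hy
    exact ⟨F, hF, y, r', x, r, .refl _, hr, hyF, hxF⟩

/-- In the presence of an element supported in all three members of `𝓕`, the margins determine the
swap class. -/
lemma SwapRel.cons_of_sameMargins [Finite ι] {F₁ F₂ F₃ : Finset ι} (h𝓕 : 𝓕 = {F₁, F₂, F₃})
    (ht : ∀ F ∈ 𝓕, SupportedIn F t) (hs : ∀ z ∈ s, ∃ F ∈ 𝓕, SupportedIn F z)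
    (hs' : ∀ z ∈ s', ∃ F ∈ 𝓕, SupportedIn F z) (h : SameMargins s s') :
    SwapRel 𝓕 (t ::ₘ s) (t ::ₘ s') := by
  induction hn : s.card generalizing s s' with
  | zero =>
    rw [Multiset.card_eq_zero] at hn
    have h0 : s' = 0 := by rw [← Multiset.card_eq_zero, ← h.1, hn]; rfl
    rw [hn, h0]
    exact .refl _
  | succ n ih =>
    obtain ⟨F, hF, y, r, y', r', hr, hr', hyF, hyF'⟩ :=
      SwapRel.exists_common_support h𝓕 hs hs' h (by rintro rfl; simp at hn)
    have hm : ∀ j, (y ::ₘ r).map (· j) = (y' ::ₘ r').map (· j) := fun j => by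
      rw [← hr.map_eval j, ← hr'.map_eval j]; exact h.2 j
    -- The common target x takes a nonzero value wherever the margin at a coordinate of F has one.
    have hx : ∀ j, ∃ c : V j, (j ∉ F → c = 0) ∧ (j ∈ F → c ∈ (y ::ₘ r).map (· j) ∧
        (c = 0 → ∀ d ∈ (y ::ₘ r).map (· j), d = 0)) := by
      intro j
      by_cases hj : j ∈ F
      · by_cases hc : ∀ d ∈ (y ::ₘ r).map (· j), d = 0
        · exact ⟨y j, fun h => absurd hj h, fun _ => ⟨by simp, fun _ => hc⟩⟩
        · push Not at hc
          obtain ⟨d, hd, hd0⟩ := hc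
          exact ⟨d, fun h => absurd hj h, fun _ => ⟨hd, fun h => absurd h hd0⟩⟩
      · exact ⟨0, fun _ => rfl, fun h => absurd h hj⟩
    choose x hx0 hx using hx
    obtain ⟨q, hq, hqs⟩ := SwapRel.exists_cons_cons_of_agent (x := x) ht hF hyF hx0
      (fun z hz => hr.supportedIn hs subset_rfl z (Multiset.mem_cons_of_mem hz))
      (fun j hj => Multiset.mem_map.1 (hx j hj).1)
      (fun j hj h0 z hz => (hx j hj).2 h0 _ (Multiset.mem_map_of_mem _ hz))
    obtain ⟨q', hq', hqs'⟩ := SwapRel.exists_cons_cons_of_agent (x := x) ht hF hyF' hx0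
      (fun z hz => hr'.supportedIn hs' subset_rfl z (Multiset.mem_cons_of_mem hz))
      (fun j hj => Multiset.mem_map.1 (by rw [← hm j]; exact (hx j hj).1))
      (fun j hj h0 z hz => (hx j hj).2 h0 _ (by rw [hm j]; exact Multiset.mem_map_of_mem _ hz))
    have e : SwapRel 𝓕 (t ::ₘ s) (t ::ₘ x ::ₘ q) := (hr.cons t).trans hq
    have e' : SwapRel 𝓕 (t ::ₘ s') (t ::ₘ x ::ₘ q') := (hr'.cons t).trans hq'
    have hcard : s.card = q.card + 1 := by simpa using e.card_eq
    have hcard' : s'.card = q'.card + 1 := by simpa using e'.card_eq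
    have hqq : SameMargins q q' := by
      refine ⟨by have := h.1; omega, fun j => ?_⟩
      have h1 := e.map_eval j
      have h2 := e'.map_eval j
      simp only [Multiset.map_cons, Multiset.cons_inj_right] at h1 h2
      have h3 := h.2 j
      rw [h1, h2] at h3
      simpa using h3
    have := (ih hqs hqs' hqq (by omega)).cons x
    rw [Multiset.cons_swap x, Multiset.cons_swap x] at this
    exact e.trans (this.trans e'.symm)

end Agent

/-! ### Torsion-freeness of swap classes. -/

section TorsionFree

variable {ι : Type*} [DecidableEq ι] {V : ι → Type*} [∀ j, Zero (V j)]

/-- The class of `u` is determined by each of its positive multiples. -/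
def SwapTorsionFreeAt (𝓕 : Set (Finset ι)) (u : Multiset ((j : ι) → V j)) : Prop :=
  ∀ n : ℕ, n ≠ 0 → ∀ s, SwapRel 𝓕 (n • u) (n • s) → SwapRel 𝓕 u s

/-- No multiset equivalent to a multiple of `u` has an element supported in `F`. -/
def SwapAvoids (𝓕 : Set (Finset ι)) (u : Multiset ((j : ι) → V j)) (F : Finset ι) : Prop :=
  ∀ (n : ℕ) w, SwapRel 𝓕 (n • u) w → ∀ x ∈ w, ¬ SupportedIn F x

/-- `s` is equivalent to a multiset with an element supported in all members of `𝓕`. -/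
def HasAgent (𝓕 : Set (Finset ι)) (s : Multiset ((j : ι) → V j)) : Prop :=
  ∃ t r, SwapRel 𝓕 s (t ::ₘ r) ∧ ∀ F ∈ 𝓕, SupportedIn F t

variable {𝓕 𝓖 : Set (Finset ι)} {s s' u v w : Multiset ((j : ι) → V j)}

lemma SwapTorsionFreeAt.of_swapRel (h : SwapRel 𝓕 s s') (hs : SwapTorsionFreeAt 𝓕 s') :
    SwapTorsionFreeAt 𝓕 s :=
  fun n hn t ht => h.trans (hs n hn t ((h.symm.nsmul n).trans ht))

lemma HasAgent.of_swapRel (h : SwapRel 𝓕 s s') (hs : HasAgent 𝓕 s') : HasAgent 𝓕 s := by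
  obtain ⟨t, r, hr, ht⟩ := hs
  exact ⟨t, r, h.trans hr, ht⟩

lemma HasAgent.of_mem (h : SwapRel 𝓕 s s') {t : (j : ι) → V j} (hs : t ∈ s')
    (ht : ∀ F ∈ 𝓕, SupportedIn F t) : HasAgent 𝓕 s := by
  obtain ⟨r, rfl⟩ := Multiset.exists_cons_of_mem hs
  exact ⟨t, r, h, ht⟩

lemma SwapRel.supportedIn_singleton {F : Finset ι} (h : SwapRel {F} s s')
    (hs : ∀ x ∈ s, SupportedIn F x) : ∀ x ∈ s', SupportedIn F x := by
  simpa using h.supportedIn (𝓖 := {F}) (by simpa using hs) subset_rfl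

lemma SwapStep.exists_add_left {c : Multiset ((j : ι) → V j)} (h : SwapStep 𝓕 (u + v) c)
    (hv : ∀ F ∈ 𝓕, ∀ x ∈ v, ¬ SupportedIn F x) : ∃ u', c = u' + v ∧ SwapStep 𝓕 u u' := by
  generalize hb : u + v = b at h
  obtain ⟨F, hF, x, y, hx, hy, l, r⟩ := h
  have hxu : x ∈ u := by
    have : x ∈ u + v := by rw [hb]; simp
    exact (Multiset.mem_add.1 this).resolve_right fun h => hv F hF x h hx
  obtain ⟨u, rfl⟩ := Multiset.exists_cons_of_mem hxu
  rw [Multiset.cons_add, Multiset.cons_inj_right] at hb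
  have hyu : y ∈ u := by
    have : y ∈ u + v := by rw [hb]; simp
    exact (Multiset.mem_add.1 this).resolve_right fun h => hv F hF y h hy
  obtain ⟨u, rfl⟩ := Multiset.exists_cons_of_mem hyu
  rw [Multiset.cons_add, Multiset.cons_inj_right] at hb
  subst hb
  exact ⟨_, by simp [Multiset.cons_add], .swap F hF x y hx hy l u⟩

/-- If neither part ever reaches an element supported in a member of the other family, each swap
acts within one part. -/
lemma SwapRel.exists_add
    (hu : ∀ G ∈ 𝓖, ∀ u', SwapRel 𝓕 u u' → ∀ x ∈ u', ¬ SupportedIn G x)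
    (hv : ∀ F ∈ 𝓕, ∀ v', SwapRel 𝓖 v v' → ∀ x ∈ v', ¬ SupportedIn F x)
    (h : SwapRel (𝓕 ∪ 𝓖) (u + v) w) :
    ∃ u' v', w = u' + v' ∧ SwapRel 𝓕 u u' ∧ SwapRel 𝓖 v v' := by
  induction h with
  | refl => exact ⟨u, v, rfl, .refl _, .refl _⟩
  | tail _ h ih =>
    obtain ⟨u', v', rfl, hu', hv'⟩ := ih
    generalize hb : u' + v' = b at h
    obtain ⟨F, hF | hF, x, y, hx, hy, l, r⟩ := h
    · have hstep := SwapStep.swap F hF x y hx hy l r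
      rw [← hb] at hstep
      obtain ⟨u'', e, h''⟩ := hstep.exists_add_left fun F hF => hv F hF v' hv'
      exact ⟨u'', v', e, hu'.tail h'', hv'⟩
    · have hstep := SwapStep.swap F hF x y hx hy l r
      rw [← hb, add_comm] at hstep
      obtain ⟨v'', e, h''⟩ := hstep.exists_add_left fun F hF => hu F hF u' hu'
      exact ⟨u', v'', e.trans (add_comm _ _), hu', hv'.tail h''⟩

/-- The two parts of n • s are told apart by support in a member of 𝓕, so filtering s by this
property divides both of them by n. -/
lemma SwapTorsionFreeAt.add (hu : SwapTorsionFreeAt 𝓕 u) (hv : SwapTorsionFreeAt 𝓖 v)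
    (hus : ∀ x ∈ u, ∃ F ∈ 𝓕, SupportedIn F x) (hu' : ∀ G ∈ 𝓖, SwapAvoids 𝓕 u G)
    (hv' : ∀ F ∈ 𝓕, SwapAvoids 𝓖 v F) : SwapTorsionFreeAt (𝓕 ∪ 𝓖) (u + v) := by
  classical
  intro n hn s h
  rw [nsmul_add] at h
  obtain ⟨a, b, hab, ha, hb⟩ := SwapRel.exists_add (fun G hG => hu' G hG n)
    (fun F hF => hv' F hF n) h
  let P : ((j : ι) → V j) → Prop := fun x => ∃ F ∈ 𝓕, SupportedIn F x
  have haP : ∀ x ∈ a, P x := ha.supportedIn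
    (fun x hx => hus x (Multiset.mem_of_mem_nsmul hx)) subset_rfl
  have hbP : ∀ x ∈ b, ¬ P x := fun x hx ⟨F, hF, hxF⟩ => hv' F hF n b hb x hx hxF
  have e1 : n • s.filter P = a := by
    rw [← Multiset.filter_nsmul, hab, Multiset.filter_add, Multiset.filter_eq_self.2 haP,
      Multiset.filter_eq_nil.2 hbP, add_zero]
  have e2 : n • s.filter (¬ P ·) = b := by
    rw [← Multiset.filter_nsmul, hab, Multiset.filter_add, Multiset.filter_eq_self.2 hbP,
      Multiset.filter_eq_nil.2 fun x hx => not_not.2 (haP x hx), zero_add]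
  rw [← Multiset.filter_add_not P s]
  rw [← e1] at ha
  rw [← e2] at hb
  exact ((hu n hn _ ha).mono Set.subset_union_left).add
    ((hv n hn _ hb).mono Set.subset_union_right)

lemma SwapRel.ne_zero_of_nsmul {n : ℕ} {j : ι} (hv : ∀ x ∈ v, x j ≠ 0)
    (h : SwapRel 𝓕 (n • v) w) : ∀ x ∈ w, x j ≠ 0 := by
  intro x hx h0
  have : (0 : V j) ∈ (n • v).map (· j) := by
    rw [h.map_eval j, ← h0]; exact Multiset.mem_map_of_mem _ hx
  obtain ⟨z, hz, hz0⟩ := Multiset.mem_map.1 this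
  exact hv z (Multiset.mem_of_mem_nsmul hz) hz0

/-- Avoidance passes from v to its multiples because it is witnessed by a margin: some coordinate
outside G is nonzero throughout v. Otherwise an element of v could gather zeros and be truncated to
G. -/
lemma SwapAvoids.of_singleton [Finite ι] {F G : Finset ι} (hv : ∀ x ∈ v, SupportedIn F x)
    (h : ∀ w, SwapRel {F} v w → ∀ x ∈ w, ¬ SupportedIn G x) : SwapAvoids {F} v G := by
  intro n w hw
  rcases Multiset.empty_or_exists_mem v with rfl | ⟨z, hz⟩
  · have := hw.card_eq
    simp only [smul_zero, Multiset.card_zero] at this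
    rw [Multiset.card_eq_zero.1 this.symm]
    simp
  obtain ⟨j, hj, hne⟩ : ∃ j ∉ G, ∀ x ∈ v, x j ≠ 0 := by
    by_contra! hcon
    obtain ⟨r, rfl⟩ := Multiset.exists_cons_of_mem hz
    obtain ⟨q, hq⟩ := SwapRel.exists_cons (𝓕 := {F}) (t := z) (s := r)
      (x := fun j => if j ∈ G then z j else 0) (by simpa using hv z hz)
      (by
        rintro _ rfl j hj
        simp [hv z hz j hj])
      (fun w hw => ⟨F, rfl, hv w (Multiset.mem_cons_of_mem hw)⟩) (fun j => by
        by_cases hj : j ∈ G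
        · exact ⟨z, hz, by simp [hj]⟩
        · simpa [hj] using hcon j hj)
    exact h _ hq _ (Multiset.mem_cons_self _ _) fun j hj => by simp [hj]
  exact fun x hx hG => hw.ne_zero_of_nsmul hne x hx (hG j hj)

lemma SameMargins.of_nsmul {n : ℕ} (hn : n ≠ 0) (h : SwapRel 𝓕 (n • s) (n • s')) :
    SameMargins s s' := by
  refine ⟨?_, fun j => ?_⟩
  · have := h.card_eq
    simp only [Multiset.card_nsmul] at this
    simpa [hn] using this
  · have := h.map_eval j
    rw [Multiset.map_nsmul, Multiset.map_nsmul] at this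
    classical
    ext c
    have := congrArg (Multiset.count c) this
    simpa [hn] using this

/-- The margins agree, so the agent of `s'` can be swapped into the agent of `s`. With a common
agent the margins of the remainders decide. -/
lemma HasAgent.swapRel [Finite ι] {F₁ F₂ F₃ : Finset ι} (h𝓕 : 𝓕 = {F₁, F₂, F₃})
    (hs : ∀ z ∈ s, ∃ F ∈ 𝓕, SupportedIn F z) (hs' : ∀ z ∈ s', ∃ F ∈ 𝓕, SupportedIn F z)
    (h : SameMargins s s') (ha : HasAgent 𝓕 s) (ha' : HasAgent 𝓕 s') : SwapRel 𝓕 s s' := by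
  obtain ⟨t, r, hr, ht⟩ := ha
  obtain ⟨t', r', hr', ht'⟩ := ha'
  have hrs := hr.supportedIn hs subset_rfl
  have hrs' := hr'.supportedIn hs' subset_rfl
  obtain ⟨q, hq⟩ := SwapRel.exists_cons (x := t) ht' ht
    (fun z hz => hrs' z (Multiset.mem_cons_of_mem hz)) (fun j => Multiset.mem_map.1 (by
      rw [← hr'.map_eval j, ← h.2 j, hr.map_eval j]; simp))
  have e := hr'.trans hq
  have hqs := hq.supportedIn hrs' subset_rfl
  have hm : SameMargins r q := by
    refine ⟨?_, fun j => ?_⟩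
    · have h1 := hr.card_eq
      have h2 := e.card_eq
      have h3 := h.1
      simp only [Multiset.card_cons] at h1 h2
      omega
    · have h3 := h.2 j
      rw [hr.map_eval j, e.map_eval j] at h3
      simpa using h3
  exact (hr.trans (.cons_of_sameMargins h𝓕 ht
    (fun z hz => hrs z (Multiset.mem_cons_of_mem hz))
    (fun z hz => hqs z (Multiset.mem_cons_of_mem hz)) hm)).trans e.symm

lemma swapTorsionFreeAt_empty : SwapTorsionFreeAt (∅ : Set (Finset ι)) u := by
  intro n hn s h
  have h := h.eq_of_empty
  obtain rfl : u = s := by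
    classical
    ext c
    have := congrArg (Multiset.count c) h
    simpa [hn] using this
  exact .refl _

/-- If both multisets have agents, margins suffice; otherwise the relation is symmetric and one side
is torsion-free already. -/
lemma swapTorsionFreeAt_of_hasAgent_or [Finite ι] {F₁ F₂ F₃ : Finset ι}
    (h𝓕 : 𝓕 = {F₁, F₂, F₃})
    (hD : ∀ s : Multiset ((j : ι) → V j), (∀ z ∈ s, ∃ F ∈ 𝓕, SupportedIn F z) →
      HasAgent 𝓕 s ∨ SwapTorsionFreeAt 𝓕 s)
    (s : Multiset ((j : ι) → V j)) : SwapTorsionFreeAt 𝓕 s := by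
  classical
  have key : ∀ s : Multiset ((j : ι) → V j), (∀ z ∈ s, ∃ F ∈ 𝓕, SupportedIn F z) →
      SwapTorsionFreeAt 𝓕 s := by
    intro s hs
    rcases hD s hs with ha | h
    swap
    · exact h
    intro n hn s' h
    have hs' : ∀ z ∈ s', ∃ F ∈ 𝓕, SupportedIn F z := fun z hz =>
      h.supportedIn (fun x hx => hs x (Multiset.mem_of_mem_nsmul hx)) subset_rfl z
        ((Multiset.mem_nsmul_of_ne_zero hn).2 hz)
    rcases hD s' hs' with ha' | h'
    · exact ha.swapRel h𝓕 hs hs' (.of_nsmul hn h) ha'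
    · exact (h' n hn s h.symm).symm
  -- Elements supported in no member are never moved, so they split off with the empty family.
  let P : ((j : ι) → V j) → Prop := fun x => ∃ F ∈ 𝓕, SupportedIn F x
  have := SwapTorsionFreeAt.add (𝓕 := 𝓕) (𝓖 := ∅) (u := s.filter P) (v := s.filter (¬ P ·))
    (key _ fun z hz => (Multiset.mem_filter.1 hz).2) swapTorsionFreeAt_empty
    (fun z hz => (Multiset.mem_filter.1 hz).2) (by simp) (by
      intro F hF n w hw x hx hxF
      rw [← hw.eq_of_empty] at hx
      exact (Multiset.mem_filter.1 (Multiset.mem_of_mem_nsmul hx)).2 ⟨F, hF, hxF⟩)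
  rwa [Set.union_empty, Multiset.filter_add_not] at this

lemma swapTorsionFreeAt_singleton [Finite ι] (F : Finset ι) (s : Multiset ((j : ι) → V j)) :
    SwapTorsionFreeAt {F} s := by
  refine swapTorsionFreeAt_of_hasAgent_or (F₁ := F) (F₂ := F) (F₃ := F) (by simp) ?_ s
  intro s hs
  rcases Multiset.empty_or_exists_mem s with rfl | ⟨z, hz⟩
  · right
    intro n hn s' h
    have := h.card_eq
    simp only [smul_zero, Multiset.card_zero, Multiset.card_nsmul] at this
    have h0 : s' = 0 := by simpa [hn] using this.symm
    rw [h0]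
    exact .refl _
  · left
    refine .of_mem (.refl s) hz ?_
    simpa using hs z hz

/-- Without an agent, the part supported in F and the rest, supported in G, never interact. -/
lemma swapTorsionFreeAt_pair [Finite ι] (F G : Finset ι) (s : Multiset ((j : ι) → V j)) :
    SwapTorsionFreeAt {F, G} s := by
  classical
  refine swapTorsionFreeAt_of_hasAgent_or (F₁ := F) (F₂ := G) (F₃ := G) (by simp) ?_ s
  intro s hs
  by_cases hc : ∃ w, SwapRel {F, G} s w ∧ ∃ x ∈ w, SupportedIn F x ∧ SupportedIn G x
  · obtain ⟨w, hw, x, hx, hF, hG⟩ := hc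
    exact .inl (.of_mem hw hx (by simp [hF, hG]))
  right
  push Not at hc
  have e := Multiset.filter_add_not (SupportedIn F) s
  have hu : ∀ x ∈ s.filter (SupportedIn F), SupportedIn F x :=
    fun x hx => (Multiset.mem_filter.1 hx).2
  have hv : ∀ x ∈ s.filter (¬ SupportedIn F ·), SupportedIn G x := fun x hx => by
    obtain ⟨hx, hxF⟩ := Multiset.mem_filter.1 hx
    simpa [hxF] using hs x hx
  rw [← e, Set.insert_eq]
  refine .add (swapTorsionFreeAt_singleton F _) (swapTorsionFreeAt_singleton G _)
    (fun x hx => ⟨F, rfl, hu x hx⟩) ?_ ?_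
  · simp only [Set.mem_singleton_iff, forall_eq]
    refine .of_singleton hu fun w hw x hx hxG => ?_
    have hxF := hw.supportedIn_singleton hu x hx
    have := (hw.mono (𝓖 := {F, G}) (by simp)).add_right (s.filter (¬ SupportedIn F ·))
    rw [e] at this
    exact hc _ this x (Multiset.mem_add.2 (.inl hx)) hxF hxG
  · simp only [Set.mem_singleton_iff, forall_eq]
    refine .of_singleton hv fun w hw x hx hxF => ?_
    have hxG := hw.supportedIn_singleton hv x hx
    have := (SwapRel.refl (𝓕 := {F, G}) (s.filter (SupportedIn F))).add
      (hw.mono (by simp))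
    rw [e] at this
    exact hc _ this x (Multiset.mem_add.2 (.inr hx)) hxF hxG

/-- The element e is an agent for F and G. Whenever the parts governed by {F, G} and by {H} could
interact, e could collect zeros outside H and become an agent for all three. -/
lemma hasAgent_or_swapTorsionFreeAt_of_mem [Finite ι] {F G H : Finset ι} (h𝓕 : 𝓕 = {F, G, H})
    (hs : ∀ z ∈ s, ∃ F ∈ 𝓕, SupportedIn F z) {e : (j : ι) → V j} (he : e ∈ s)
    (heF : SupportedIn F e) (heG : SupportedIn G e) :
    HasAgent 𝓕 s ∨ SwapTorsionFreeAt 𝓕 s := by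
  classical
  by_contra! hcon
  obtain ⟨hna, hnt⟩ := hcon
  apply hnt
  let P : ((j : ι) → V j) → Prop := fun x => SupportedIn F x ∨ SupportedIn G x
  have es := Multiset.filter_add_not P s
  have hu : ∀ x ∈ s.filter P, ∃ F' ∈ ({F, G} : Set (Finset ι)), SupportedIn F' x :=
    fun x hx => by simpa using (Multiset.mem_filter.1 hx).2
  have hv : ∀ x ∈ s.filter (¬ P ·), SupportedIn H x := fun x hx => by
    obtain ⟨hx, hxP⟩ := Multiset.mem_filter.1 hx
    simp only [P, not_or] at hxP
    simpa [h𝓕, hxP] using hs x hx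
  have heu : e ∈ s.filter P := Multiset.mem_filter.2 ⟨he, .inl heF⟩
  have hxF : ∀ F', SupportedIn F' e → SupportedIn F' fun j => if j ∈ H then e j else 0 := by
    intro F' h j hj
    simp [h j hj]
  have hxH : SupportedIn H fun j => if j ∈ H then e j else 0 := by
    intro j hj
    simp [hj]
  have hx𝓕 : ∀ F' ∈ 𝓕, SupportedIn F' fun j => if j ∈ H then e j else 0 := by
    simp [h𝓕, hxF F heF, hxF G heG, hxH]
  obtain ⟨j, hjH, hne⟩ : ∃ j ∉ H, ∀ x ∈ s.filter P, x j ≠ 0 := by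
    by_contra! hj
    obtain ⟨r, hr⟩ := Multiset.exists_cons_of_mem heu
    rw [hr] at hj hu
    obtain ⟨q, hq⟩ := SwapRel.exists_cons (𝓕 := {F, G}) (t := e) (s := r)
      (x := fun j => if j ∈ H then e j else 0) (by simp [heF, heG])
      (fun F' hF' => hx𝓕 F' (by rw [h𝓕]; aesop))
      (fun z hz => hu z (Multiset.mem_cons_of_mem hz))
      (fun j => by
        by_cases hjH : j ∈ H
        · exact ⟨e, by simp, by simp [hjH]⟩
        · simpa [hjH] using hj j hjH)
    rw [← hr] at hq
    have := (hq.mono (𝓖 := 𝓕) (by rw [h𝓕]; intro; aesop)).add_right (s.filter (¬ P ·))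
    rw [es] at this
    exact hna (.of_mem this (by simp) hx𝓕)
  have h𝓕' : 𝓕 = {F, G} ∪ {H} := by
    rw [h𝓕]; ext; simp only [Set.mem_union, Set.mem_insert_iff, Set.mem_singleton_iff, or_assoc]
  rw [← es, h𝓕']
  refine .add (swapTorsionFreeAt_pair F G _) (swapTorsionFreeAt_singleton H _) hu ?_ ?_
  · simp only [Set.mem_singleton_iff, forall_eq]
    intro n w hw x hx hxH
    exact hw.ne_zero_of_nsmul hne x hx (hxH j hjH)
  · intro F' hF'
    have heF' : SupportedIn F' e := by
      rcases hF' with rfl | rfl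
      exacts [heF, heG]
    refine .of_singleton hv fun w hw f hf hfF => ?_
    have hfH := hw.supportedIn_singleton hv f hf
    obtain ⟨r, hr⟩ := Multiset.exists_cons_of_mem heu
    obtain ⟨q, rfl⟩ := Multiset.exists_cons_of_mem hf
    -- Outside H the element f is zero, so swapping with f inside F' truncates e to H.
    obtain ⟨p, hp⟩ := SwapRel.exists_cons (𝓕 := {F'}) (t := e) (s := {f})
      (x := fun j => if j ∈ H then e j else 0) (by simp [heF'])
      (by simpa using hxF F' heF') (by simpa using hfF)
      (fun j => by
        by_cases hj : j ∈ H
        · exact ⟨e, by simp, by simp [hj]⟩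
        · exact ⟨f, by simp, by simp [hj, hfH j hj]⟩)
    have h1 := (SwapRel.refl (𝓕 := 𝓕) (s.filter P)).add (hw.mono (𝓖 := 𝓕) (by simp [h𝓕]))
    have h2 := (hp.mono (𝓖 := 𝓕) (by
      rw [h𝓕']; exact Set.singleton_subset_iff.2 (.inl hF'))).add_right (r + q)
    rw [es, hr] at h1
    have e2 : e ::ₘ {f} + (r + q) = e ::ₘ r + f ::ₘ q := by
      simp only [← Multiset.singleton_add]
      abel
    rw [e2] at h2
    exact hna (.of_mem (h1.trans h2) (by simp) hx𝓕)

/-- If no equivalent multiset has an element supported in two of the sets, the three parts never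
interact. Otherwise such an element reduces the claim to `hasAgent_or_swapTorsionFreeAt_of_mem`. -/
lemma swapTorsionFreeAt_triple [Finite ι] (F G H : Finset ι) (s : Multiset ((j : ι) → V j)) :
    SwapTorsionFreeAt {F, G, H} s := by
  classical
  refine swapTorsionFreeAt_of_hasAgent_or rfl ?_ s
  intro s hs
  by_cases hc : ∃ w, SwapRel {F, G, H} s w ∧ ∃ x ∈ w, (SupportedIn F x ∧ SupportedIn G x) ∨
      (SupportedIn F x ∧ SupportedIn H x) ∨ (SupportedIn G x ∧ SupportedIn H x)
  · obtain ⟨w, hw, x, hx, h⟩ := hc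
    have hws := hw.supportedIn hs subset_rfl
    have : HasAgent {F, G, H} w ∨ SwapTorsionFreeAt {F, G, H} w := by
      rcases h with ⟨h, h'⟩ | ⟨h, h'⟩ | ⟨h, h'⟩
      · exact hasAgent_or_swapTorsionFreeAt_of_mem rfl hws hx h h'
      · exact hasAgent_or_swapTorsionFreeAt_of_mem (H := G) (by grind) hws hx h h'
      · exact hasAgent_or_swapTorsionFreeAt_of_mem (H := F) (by grind) hws hx h h'
    exact this.imp (.of_swapRel hw) (.of_swapRel hw)
  right
  push Not at hc
  let P : ((j : ι) → V j) → Prop := fun x => SupportedIn F x ∨ SupportedIn G x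
  have es := Multiset.filter_add_not P s
  have hu : ∀ x ∈ s.filter P, ∃ F' ∈ ({F, G} : Set (Finset ι)), SupportedIn F' x :=
    fun x hx => by simpa using (Multiset.mem_filter.1 hx).2
  have hv : ∀ x ∈ s.filter (¬ P ·), SupportedIn H x := fun x hx => by
    obtain ⟨hx, hxP⟩ := Multiset.mem_filter.1 hx
    simp only [P, not_or] at hxP
    simpa [hxP] using hs x hx
  have eu := Multiset.filter_add_not (SupportedIn F) (s.filter P)
  set u₁ := (s.filter P).filter (SupportedIn F)
  set u₂ := (s.filter P).filter (¬ SupportedIn F ·)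
  set v := s.filter (¬ P ·)
  have hu₁ : ∀ x ∈ u₁, SupportedIn F x := fun x hx => (Multiset.mem_filter.1 hx).2
  have hu₂ : ∀ x ∈ u₂, SupportedIn G x := fun x hx => by
    obtain ⟨hx, hxF⟩ := Multiset.mem_filter.1 hx
    simpa [hxF] using hu x hx
  have avoid : ∀ F₁ ∈ ({F, G, H} : Set (Finset ι)), ∀ F₂ a b, s = a + b →
      (∀ x ∈ a, SupportedIn F₁ x) →
      (∀ w, SwapRel {F, G, H} s w → ∀ x ∈ w, ¬ (SupportedIn F₁ x ∧ SupportedIn F₂ x)) →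
      SwapAvoids {F₁} a F₂ := by
    intro F₁ hF₁ F₂ a b hab ha hno
    refine .of_singleton ha fun w hw x hx hxF => ?_
    have hx₁ := hw.supportedIn_singleton ha x hx
    have := (hw.mono (𝓖 := {F, G, H}) (by simpa using hF₁)).add_right b
    rw [← hab] at this
    exact hno _ this x (Multiset.mem_add.2 (.inl hx)) ⟨hx₁, hxF⟩
  have hs₁ : s = u₁ + (u₂ + v) := by rw [← add_assoc, eu, es]
  have hs₂ : s = u₂ + (u₁ + v) := by rw [hs₁]; abel
  have hsv : s = v + (u₁ + u₂) := by rw [hs₁]; abel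
  have h𝓕' : ({F, G, H} : Set (Finset ι)) = {F, G} ∪ {H} := by
    ext; simp only [Set.mem_union, Set.mem_insert_iff, Set.mem_singleton_iff, or_assoc]
  have hrel : SwapTorsionFreeAt ({F, G} ∪ {H}) (s.filter P + v) := by
    refine .add (swapTorsionFreeAt_pair F G _) (swapTorsionFreeAt_singleton H _) hu ?_ ?_
    · simp only [Set.mem_singleton_iff, forall_eq]
      intro n w hw x hx hxH
      -- To see that the {F, G}-part avoids H, its swaps are first separated into those of F and
      -- those of G.
      rw [← eu, nsmul_add, Set.insert_eq] at hw
      obtain ⟨a, b, rfl, ha, hb⟩ := SwapRel.exists_add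
        (by
          rintro _ rfl
          exact avoid F (by simp) _ u₁ _ hs₁ hu₁ (fun w hw x hx h => (hc w hw x hx).1 h.1 h.2) n)
        (by
          rintro _ rfl
          exact avoid G (by simp) _ u₂ _ hs₂ hu₂ (fun w hw x hx h => (hc w hw x hx).1 h.2 h.1) n)
        hw
      rcases Multiset.mem_add.1 hx with hx | hx
      · exact avoid F (by simp) _ u₁ _ hs₁ hu₁
          (fun w hw x hx h => (hc w hw x hx).2.1 h.1 h.2) n a ha x hx hxH
      · exact avoid G (by simp) _ u₂ _ hs₂ hu₂
          (fun w hw x hx h => (hc w hw x hx).2.2 h.1 h.2) n b hb x hx hxH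
    · rintro _ (rfl | rfl)
      · exact avoid H (by simp) _ v _ hsv hv fun w hw x hx h => (hc w hw x hx).2.1 h.2 h.1
      · exact avoid H (by simp) _ v _ hsv hv fun w hw x hx h => (hc w hw x hx).2.2 h.2 h.1
  rwa [es, ← h𝓕'] at hrel

end TorsionFree

/-! ### The binomial ideal and its quotient as a monoid algebra. -/

section SwapIdeal

variable {ι : Type*} [DecidableEq ι] {V : ι → Type*} [∀ j, Zero (V j)]

/-- Swap equivalence as an additive congruence. -/
def swapCon (V : ι → Type*) [∀ j, Zero (V j)] (𝓕 : Set (Finset ι)) :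
    AddCon (Multiset ((j : ι) → V j)) where
  r := SwapRel 𝓕
  iseqv := ⟨.refl, .symm, .trans⟩
  add' := .add

/-- The binomial ideal of the swaps. -/
noncomputable def swapIdeal (K : Type*) [Field K] (V : ι → Type*) [∀ j, Zero (V j)] (𝓕 : Set (Finset ι)) :
    Ideal (MvPolynomial ((j : ι) → V j) K) :=
  Ideal.span {f | ∃ F ∈ 𝓕, ∃ x y : (j : ι) → V j, SupportedIn F x ∧ SupportedIn F y ∧ ∃ l,
    f = MvPolynomial.X x * MvPolynomial.X y -
      MvPolynomial.X (Function.update x l (y l)) * MvPolynomial.X (Function.update y l (x l))}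

/-- The monomial with the given multiset of variables. -/
noncomputable def multisetMonomial (K : Type*) [Field K] {σ : Type*} (s : Multiset σ) :
    MvPolynomial σ K :=
  (s.map MvPolynomial.X).prod

lemma monomial_eq_C_mul_multisetMonomial {K : Type*} [Field K] {σ : Type*} (a : σ →₀ ℕ) (c : K) :
    MvPolynomial.monomial a c = MvPolynomial.C c * multisetMonomial K (Finsupp.toMultiset a) := by
  rw [MvPolynomial.monomial_eq, multisetMonomial, Finsupp.toMultiset_map, Finsupp.prod_toMultiset,
    Finsupp.prod_mapDomain_index (by simp) (by intros; rw [pow_add])]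

/-- The quotient map from the polynomial ring to the monoid algebra of swap classes. -/
noncomputable def swapQuotientMap (K : Type*) [Field K] (V : ι → Type*) [∀ j, Zero (V j)]
    (𝓕 : Set (Finset ι)) :
    MvPolynomial ((j : ι) → V j) K →ₐ[K] AddMonoidAlgebra K (swapCon V 𝓕).Quotient :=
  MvPolynomial.aeval fun x => AddMonoidAlgebra.single ((swapCon V 𝓕).mk' {x}) 1

variable {K : Type*} [Field K] {𝓕 : Set (Finset ι)}

lemma swapQuotientMap_multisetMonomial (s : Multiset ((j : ι) → V j)) :
    swapQuotientMap K V 𝓕 (multisetMonomial K s) =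
      AddMonoidAlgebra.single ((swapCon V 𝓕).mk' s) 1 := by
  induction s using Multiset.induction_on with
  | empty =>
    have e : multisetMonomial K (0 : Multiset ((j : ι) → V j)) = 1 := by simp [multisetMonomial]
    rw [e, map_one, map_zero, AddMonoidAlgebra.one_def]
  | cons x s ih =>
    have e : multisetMonomial K (x ::ₘ s) = MvPolynomial.X x * multisetMonomial K s := by
      simp [multisetMonomial]
    rw [e, map_mul, ih, swapQuotientMap, MvPolynomial.aeval_X, AddMonoidAlgebra.single_mul_single,
      ← map_add, Multiset.singleton_add, one_mul]

lemma multisetMonomial_sub_mem_swapIdeal {s t : Multiset ((j : ι) → V j)} (h : SwapRel 𝓕 s t) :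
    multisetMonomial K s - multisetMonomial K t ∈ swapIdeal K V 𝓕 := by
  induction h with
  | refl => simp
  | tail _ h ih =>
    rw [← sub_add_sub_cancel]
    refine add_mem ih ?_
    obtain ⟨F, hF, x, y, hx, hy, l, r⟩ := h
    have := (swapIdeal K V 𝓕).mul_mem_right (multisetMonomial K r)
      (Ideal.subset_span ⟨F, hF, x, y, hx, hy, l, rfl⟩)
    convert this using 1
    simp only [multisetMonomial, Multiset.map_cons, Multiset.prod_cons]
    ring

/-- Choosing a representative of each class gives a linear section `τ`. Every polynomial is
congruent to the section of its image, since equivalent monomials are congruent. -/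
lemma mem_swapIdeal_of_map_eq_zero {f : MvPolynomial ((j : ι) → V j) K}
    (hf : swapQuotientMap K V 𝓕 f = 0) : f ∈ swapIdeal K V 𝓕 := by
  obtain ⟨σ, hσ⟩ := (AddCon.mk'_surjective (c := swapCon V 𝓕)).hasRightInverse
  let τ : AddMonoidAlgebra K (swapCon V 𝓕).Quotient →ₗ[K] MvPolynomial ((j : ι) → V j) K :=
    Finsupp.linearCombination K (fun m => multisetMonomial K (σ m)) ∘ₗ
      (AddMonoidAlgebra.coeffLinearEquiv K).toLinearMap
  have key : ∀ g, g - τ (swapQuotientMap K V 𝓕 g) ∈ swapIdeal K V 𝓕 := by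
    intro g
    induction g using MvPolynomial.induction_on' with
    | monomial a c =>
      rw [monomial_eq_C_mul_multisetMonomial, ← MvPolynomial.smul_eq_C_mul, map_smul, map_smul,
        ← smul_sub, swapQuotientMap_multisetMonomial]
      refine Submodule.smul_of_tower_mem _ c ?_
      have : τ (AddMonoidAlgebra.single ((swapCon V 𝓕).mk' (Finsupp.toMultiset a)) 1) =
          multisetMonomial K (σ ((swapCon V 𝓕).mk' (Finsupp.toMultiset a))) := by
        simp [τ]
      rw [this]
      exact multisetMonomial_sub_mem_swapIdeal (((swapCon V 𝓕).eq).1 (hσ _).symm)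
    | add p q hp hq =>
      rw [map_add, map_add, add_sub_add_comm]
      exact add_mem hp hq
  simpa [hf] using key f

lemma map_eq_zero_of_mem_swapIdeal {f : MvPolynomial ((j : ι) → V j) K}
    (hf : f ∈ swapIdeal K V 𝓕) : swapQuotientMap K V 𝓕 f = 0 := by
  have : swapIdeal K V 𝓕 ≤ RingHom.ker (swapQuotientMap K V 𝓕) := by
    rw [swapIdeal, Ideal.span_le]
    rintro _ ⟨F, hF, x, y, hx, hy, l, rfl⟩
    have h : ∀ a b : (j : ι) → V j, swapQuotientMap K V 𝓕 (MvPolynomial.X a * MvPolynomial.X b) =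
        AddMonoidAlgebra.single ((swapCon V 𝓕).mk' (a ::ₘ b ::ₘ 0)) 1 := by
      intro a b
      rw [← swapQuotientMap_multisetMonomial]
      simp [multisetMonomial]
    rw [SetLike.mem_coe, RingHom.mem_ker, map_sub, h, h, sub_eq_zero]
    congr 1
    exact ((swapCon V 𝓕).eq).2 (.swap hF hx hy l 0)
  exact this hf

lemma swapIdeal_isRadical (h : ∀ s : Multiset ((j : ι) → V j), SwapTorsionFreeAt 𝓕 s) :
    (swapIdeal K V 𝓕).IsRadical := by
  have : IsReduced (AddMonoidAlgebra K (swapCon V 𝓕).Quotient) := by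
    refine AddMonoidAlgebra.isReduced_of_nsmul_injective fun n hn a b hab => ?_
    obtain ⟨s, rfl⟩ := AddCon.mk'_surjective (c := swapCon V 𝓕) a
    obtain ⟨t, rfl⟩ := AddCon.mk'_surjective (c := swapCon V 𝓕) b
    simp only [← map_nsmul] at hab
    exact ((swapCon V 𝓕).eq).2 (h s n hn t (((swapCon V 𝓕).eq).1 hab))
  rintro f ⟨n, hn⟩
  apply mem_swapIdeal_of_map_eq_zero
  have := map_eq_zero_of_mem_swapIdeal hn
  rw [map_pow] at this
  exact eq_zero_of_pow_eq_zero this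

end SwapIdeal

/-! ### Linear changes of coordinates on tables. -/

lemma tableMinor_eq {ι : Type*} [DecidableEq ι] {b : ι → ℕ} {R : Type*} [CommRing R]
    (B : ((j : ι) → Fin (b j)) → R)
    (l : ι) (i k : (j : ι) → Fin (b j)) :
    tableMinor B l i k =
      B i * B k - B (Function.update k l (i l)) * B (Function.update i l (k l)) := by
  rw [tableMinor, Matrix.det_fin_two_of]

section Act

variable {ι : Type*} [Fintype ι] [DecidableEq ι] {b : ι → ℕ} {R : Type*} [CommRing R]

/-- The table obtained from `B` by acting with the matrix `U j` on the `j`-th coordinate. -/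
def tableAct (U : (j : ι) → Matrix (Fin (b j)) (Fin (b j)) ℤ) (B : ((j : ι) → Fin (b j)) → R) :
    ((j : ι) → Fin (b j)) → R :=
  fun i => ∑ k, (∏ j, U j (i j) (k j)) • B k

lemma map_tableAct {S F : Type*} [CommRing S] [FunLike F R S] [RingHomClass F R S] (φ : F)
    (U : (j : ι) → Matrix (Fin (b j)) (Fin (b j)) ℤ) (B : ((j : ι) → Fin (b j)) → R)
    (i : (j : ι) → Fin (b j)) : φ (tableAct U B i) = tableAct U (fun k => φ (B k)) i := by
  simp [tableAct]

lemma tableAct_tableAct (U W : (j : ι) → Matrix (Fin (b j)) (Fin (b j)) ℤ)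
    (B : ((j : ι) → Fin (b j)) → R) :
    tableAct U (tableAct W B) = tableAct (fun j => U j * W j) B := by
  funext i
  simp only [tableAct, Finset.smul_sum, smul_smul, Matrix.mul_apply]
  rw [Finset.sum_comm]
  refine Finset.sum_congr rfl fun m _ => ?_
  rw [← Finset.sum_smul, Finset.prod_univ_sum, Fintype.piFinset_univ]
  simp only [Finset.prod_mul_distrib]

lemma tableAct_one (B : ((j : ι) → Fin (b j)) → R) :
    tableAct (fun _ => 1) B = B := by
  funext i
  rw [tableAct, Finset.sum_eq_single i]
  · simp
  · intro k _ hk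
    obtain ⟨j, hj⟩ := Function.ne_iff.1 hk
    rw [Finset.prod_eq_zero (Finset.mem_univ j), zero_smul]
    exact Matrix.one_apply_ne hj.symm
  · simp

/-- A minor of the new table expands multilinearly into an integer combination of minors of B.
Applied also to the inverse matrices, this gives equality for invertible U. -/
lemma segreIdeal_tableAct_le (U : (j : ι) → Matrix (Fin (b j)) (Fin (b j)) ℤ)
    (B : ((j : ι) → Fin (b j)) → R) : segreIdeal (tableAct U B) ≤ segreIdeal B := by
  rw [segreIdeal, Ideal.span_le]
  rintro _ ⟨l, i, k, rfl⟩
  have hmul : ∀ x y, tableAct U B x * tableAct U B y =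
      ∑ z : ((j : ι) → Fin (b j)) × ((j : ι) → Fin (b j)),
        ((∏ j, U j (x j) (z.1 j)) * ∏ j, U j (y j) (z.2 j)) • (B z.1 * B z.2) := by
    intro x y
    rw [tableAct, tableAct, Finset.sum_mul_sum, Fintype.sum_prod_type]
    simp only [smul_mul_smul_comm]
  -- Reindexing the second product by this exchange matches its coefficients with those of the
  -- first.
  let σ : ((j : ι) → Fin (b j)) × ((j : ι) → Fin (b j)) →
      ((j : ι) → Fin (b j)) × ((j : ι) → Fin (b j)) :=
    fun z => (Function.update z.2 l (z.1 l), Function.update z.1 l (z.2 l))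
  have hσ : Function.Involutive σ := fun z => by simp [σ]
  have hc : ∀ z, (∏ j, U j (Function.update k l (i l) j) ((σ z).1 j)) *
      ∏ j, U j (Function.update i l (k l) j) ((σ z).2 j) =
      (∏ j, U j (i j) (z.1 j)) * ∏ j, U j (k j) (z.2 j) := by
    intro z
    rw [← Finset.prod_mul_distrib, ← Finset.prod_mul_distrib]
    refine Finset.prod_congr rfl fun j _ => ?_
    by_cases hj : j = l
    · subst hj; simp [σ]
    · simp [σ, hj, mul_comm]
  rw [SetLike.mem_coe, tableMinor_eq, hmul, hmul]
  rw [Fintype.sum_equiv (hσ.toPerm σ) _ (fun z => ((∏ j, U j (i j) ((σ z).1 j)) *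
    ∏ j, U j (k j) ((σ z).2 j)) • (B (σ z).1 * B (σ z).2)) fun z => by
      simp only [Function.Involutive.coe_toPerm, hσ z], ← Finset.sum_sub_distrib]
  refine sum_mem fun z _ => ?_
  have hz := hc (σ z)
  rw [hσ z] at hz
  rw [hz, ← smul_sub]
  have hm : tableMinor B l (σ z).1 (σ z).2 ∈ segreIdeal B := Ideal.subset_span ⟨l, _, _, rfl⟩
  rw [tableMinor_eq] at hm
  refine zsmul_mem ?_ _
  simpa [σ] using hm

end Act

/-- The matrix replacing the `0`-th entry of a vector by the sum of all entries. -/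
def marginMatrix (a : ℕ) [NeZero a] : Matrix (Fin a) (Fin a) ℤ :=
  fun i k => if i = 0 then 1 else if i = k then 1 else 0

/-- The inverse of `marginMatrix`. -/
def marginMatrixInv (a : ℕ) [NeZero a] : Matrix (Fin a) (Fin a) ℤ :=
  fun i k => if i = k then 1 else if i = 0 then -1 else 0

lemma marginMatrixInv_mul_marginMatrix (a : ℕ) [NeZero a] :
    marginMatrixInv a * marginMatrix a = 1 := by
  ext i k
  rw [Matrix.mul_apply]
  by_cases hi : i = 0
  · subst hi
    have h : ∀ m : Fin a, marginMatrixInv a 0 m * marginMatrix a m k =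
        (if m = 0 then 1 else 0) - (if m = k then (if k = 0 then 0 else 1) else 0) := by
      intro m
      simp only [marginMatrixInv, marginMatrix]
      grind
    simp only [h, Finset.sum_sub_distrib, Finset.sum_ite_eq', Finset.mem_univ, if_true,
      Matrix.one_apply]
    grind
  · have h : ∀ m : Fin a, marginMatrixInv a i m * marginMatrix a m k =
        if i = m then (if i = k then 1 else 0) else 0 := by
      intro m
      simp only [marginMatrixInv, marginMatrix]
      grind
    simp only [h, Finset.sum_ite_eq, Finset.mem_univ, if_true, Matrix.one_apply]

lemma marginMatrix_mul_marginMatrixInv (a : ℕ) [NeZero a] :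
    marginMatrix a * marginMatrixInv a = 1 :=
  mul_eq_one_comm.1 (marginMatrixInv_mul_marginMatrix a)

section Margins

variable {n : ℕ} {a : Fin n → ℕ} [∀ j, NeZero (a j)]

/-- Extension of a partial index by zeros. -/
def extendIndex (J : Finset (Fin n)) (s : (j : J) → Fin (a j)) : (j : Fin n) → Fin (a j) :=
  fun j => if h : j ∈ J then s ⟨j, h⟩ else 0

lemma supportedIn_extendIndex (J : Finset (Fin n)) (s : (j : J) → Fin (a j)) :
    SupportedIn J (extendIndex J s) := by
  intro j hj
  simp [extendIndex, hj]

lemma extendIndex_restrict {J : Finset (Fin n)} {x : (j : Fin n) → Fin (a j)}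
    (hx : SupportedIn J x) : extendIndex J (fun j => x j) = x := by
  funext j
  by_cases hj : j ∈ J
  · simp [extendIndex, hj]
  · simp [extendIndex, hj, hx j hj]

lemma extendIndex_update (J : Finset (Fin n)) (s : (j : J) → Fin (a j)) (l : J)
    (c : Fin (a l)) :
    extendIndex J (Function.update s l c) = Function.update (extendIndex J s) l c := by
  funext j
  by_cases hj : j = l
  · subst hj; simp [extendIndex]
  · by_cases hJ : j ∈ J
    · have : (⟨j, hJ⟩ : J) ≠ l := fun h => hj (congrArg Subtype.val h)
      simp [extendIndex, hJ, hj, this]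
    · simp [extendIndex, hJ, hj]

/-- Row 0 of each matrix consists of ones, so a coordinate 0 outside J sums that coordinate out. -/
lemma tableAct_marginMatrix_extendIndex {R : Type*} [CommRing R]
    (A : ((j : Fin n) → Fin (a j)) → R) (J : Finset (Fin n)) (s : (j : J) → Fin (a j)) :
    tableAct (fun j => marginMatrix (a j)) A (extendIndex J s) =
      tableAct (fun j : J => marginMatrix (a j)) (marginalTable A J) s := by
  have hrhs : tableAct (fun j : J => marginMatrix (a j)) (marginalTable A J) s =
      ∑ i, (∏ j : J, marginMatrix (a j) (s j) (i j)) • A i := by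
    rw [← Finset.sum_fiberwise Finset.univ (fun (i : (j : Fin n) → Fin (a j)) (j : J) => i j)]
    refine Finset.sum_congr rfl fun t _ => ?_
    rw [marginalTable, Finset.smul_sum]
    refine Finset.sum_congr (by ext i; simp [funext_iff]) fun i hi => ?_
    have hi : ∀ j : J, i j = t j := by simpa [funext_iff] using hi
    simp only [hi]
  rw [hrhs]
  refine Finset.sum_congr rfl fun i _ => ?_
  congr 1
  rw [← Finset.prod_subset (Finset.subset_univ J), ← Finset.prod_coe_sort]
  · refine Finset.prod_congr rfl fun j _ => ?_
    simp [extendIndex]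
  · intro j _ hj
    simp [extendIndex, hj, marginMatrix]

/-- The linear change of coordinates after which the margins of the generic table are generic. -/
noncomputable def marginEquiv (K : Type*) [Field K] (a : Fin n → ℕ) [∀ j, NeZero (a j)] :
    MvPolynomial ((j : Fin n) → Fin (a j)) K ≃ₐ[K] MvPolynomial ((j : Fin n) → Fin (a j)) K :=
  AlgEquiv.ofAlgHom
    (MvPolynomial.aeval (tableAct (fun j => marginMatrix (a j)) (genericTable K a)))
    (MvPolynomial.aeval (tableAct (fun j => marginMatrixInv (a j)) (genericTable K a)))
    (by
      ext1 i
      simp only [AlgHom.comp_apply, MvPolynomial.aeval_X, map_tableAct]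
      simp only [genericTable, MvPolynomial.aeval_X]
      change tableAct _ (tableAct _ (genericTable K a)) i = _
      simp only [tableAct_tableAct, marginMatrixInv_mul_marginMatrix, tableAct_one]
      rfl)
    (by
      ext1 i
      simp only [AlgHom.comp_apply, MvPolynomial.aeval_X, map_tableAct]
      simp only [genericTable, MvPolynomial.aeval_X]
      change tableAct _ (tableAct _ (genericTable K a)) i = _
      simp only [tableAct_tableAct, marginMatrix_mul_marginMatrixInv, tableAct_one]
      rfl)

lemma marginEquiv_X (K : Type*) [Field K] (i : (j : Fin n) → Fin (a j)) :
    marginEquiv K a (MvPolynomial.X i) =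
      tableAct (fun j => marginMatrix (a j)) (genericTable K a) i := by
  simp [marginEquiv]

lemma marginEquiv_swap (K : Type*) [Field K] (J : Finset (Fin n)) (s t : (j : J) → Fin (a j))
    (l : J) :
    marginEquiv K a (MvPolynomial.X (extendIndex J s) * MvPolynomial.X (extendIndex J t) -
      MvPolynomial.X (Function.update (extendIndex J s) l (extendIndex J t l)) *
        MvPolynomial.X (Function.update (extendIndex J t) l (extendIndex J s l))) =
      tableMinor (tableAct (fun j : J => marginMatrix (a j))
        (marginalTable (genericTable K a) J)) l s t := by
  have h : ∀ s : (j : J) → Fin (a j), extendIndex J s l = s l := fun s => by simp [extendIndex]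
  rw [h, h, ← extendIndex_update, ← extendIndex_update, tableMinor_eq, map_sub, map_mul, map_mul]
  simp only [marginEquiv_X, tableAct_marginMatrix_extendIndex]
  ring

lemma independenceIdeal_eq_map_swapIdeal (K : Type*) [Field K] (Δ : Set (Finset (Fin n))) :
    independenceIdeal Δ (genericTable K a) =
      (swapIdeal K (fun j => Fin (a j)) Δ).map (marginEquiv K a).toRingEquiv := by
  apply le_antisymm
  · refine iSup₂_le fun J hJ => ?_
    have hle := segreIdeal_tableAct_le (fun j : J => marginMatrixInv (a j))
      (tableAct (fun j : J => marginMatrix (a j)) (marginalTable (genericTable K a) J))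
    simp only [tableAct_tableAct, marginMatrixInv_mul_marginMatrix, tableAct_one] at hle
    refine hle.trans ?_
    rw [segreIdeal, Ideal.span_le]
    rintro _ ⟨l, s, t, rfl⟩
    rw [SetLike.mem_coe, ← marginEquiv_swap]
    exact Ideal.mem_map_of_mem _ (Ideal.subset_span ⟨J, hJ, _, _, supportedIn_extendIndex J s,
      supportedIn_extendIndex J t, l, rfl⟩)
  · rw [swapIdeal, Ideal.map_span, Ideal.span_le]
    rintro _ ⟨_, ⟨J, hJ, x, y, hx, hy, l, rfl⟩, rfl⟩
    by_cases hl : l ∈ J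
    · rw [← extendIndex_restrict hx, ← extendIndex_restrict hy]
      have := marginEquiv_swap K J (fun j => x j) (fun j => y j) ⟨l, hl⟩
      have hmem : tableMinor (tableAct (fun j : J => marginMatrix (a j))
          (marginalTable (genericTable K a) J)) ⟨l, hl⟩ (fun j => x j) (fun j => y j) ∈
          independenceIdeal Δ (genericTable K a) :=
        le_iSup₂_of_le (f := fun J (_ : J ∈ Δ) => segreIdeal (marginalTable (genericTable K a) J))
          J hJ (segreIdeal_tableAct_le _ _) (Ideal.subset_span ⟨_, _, _, rfl⟩)
      rw [← this] at hmem
      exact hmem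
    -- Outside J both entries are 0, so the swap is trivial and its binomial vanishes.
    · have h1 : Function.update x l (y l) = x := by
        rw [hy l hl, ← hx l hl, Function.update_eq_self]
      have h2 : Function.update y l (x l) = y := by
        rw [hx l hl, ← hy l hl, Function.update_eq_self]
      rw [h1, h2, sub_self]
      simp

end Margins

/-! ### Reduction to facets and conclusion. -/

lemma swapIdeal_eq_swapIdeal_facets {n : ℕ} (K : Type*) [Field K] (V : Fin n → Type*)
    [∀ j, Zero (V j)] (Δ : Set (Finset (Fin n))) : swapIdeal K V Δ = swapIdeal K V (facets Δ) := by
  apply le_antisymm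
  · refine Ideal.span_mono ?_
    rintro _ ⟨F, hF, x, y, hx, hy, h⟩
    obtain ⟨G, hFG, hG⟩ := (Set.toFinite Δ).exists_le_maximal hF
    exact ⟨G, hG, x, y, hx.mono hFG, hy.mono hFG, h⟩
  · refine Ideal.span_mono ?_
    rintro _ ⟨F, hF, h⟩
    exact ⟨F, hF.prop, h⟩

lemma swapTorsionFreeAt_of_ncard_le_three {ι : Type*} [DecidableEq ι] [Finite ι] {V : ι → Type*}
    [∀ j, Zero (V j)] {𝓕 : Set (Finset ι)} (h𝓕 : 𝓕.ncard ≤ 3)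
    (s : Multiset ((j : ι) → V j)) : SwapTorsionFreeAt 𝓕 s := by
  have h : 𝓕.ncard = 0 ∨ 𝓕.ncard = 1 ∨ 𝓕.ncard = 2 ∨ 𝓕.ncard = 3 := by omega
  rcases h with h | h | h | h
  · obtain rfl := (Set.ncard_eq_zero (Set.toFinite 𝓕)).1 h
    exact swapTorsionFreeAt_empty
  · obtain ⟨F, rfl⟩ := Set.ncard_eq_one.1 h
    exact swapTorsionFreeAt_singleton F s
  · obtain ⟨F, G, -, rfl⟩ := Set.ncard_eq_two.1 h
    exact swapTorsionFreeAt_pair F G s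
  · obtain ⟨F, G, H, -, -, -, rfl⟩ := Set.ncard_eq_three.1 h
    exact swapTorsionFreeAt_triple F G H s

lemma independenceIdeal_eq_bot_of_isEmpty {R : Type*} [CommRing R] {n : ℕ} {a : Fin n → ℕ}
    [IsEmpty ((j : Fin n) → Fin (a j))] (Δ : Set (Finset (Fin n)))
    (A : ((j : Fin n) → Fin (a j)) → R) : independenceIdeal Δ A = ⊥ := by
  rw [eq_bot_iff]
  refine iSup₂_le fun J _ => ?_
  rw [segreIdeal, Ideal.span_le]
  rintro _ ⟨l, i, k, rfl⟩
  simp [tableMinor, marginalTable]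

theorem mainTheorem3 {K : Type*} [Field K] (n : ℕ) (a : Fin n → ℕ)
    (Δ : Set (Finset (Fin n))) (hΔ : IsLowerSet Δ) (hfacets : (facets Δ).ncard ≤ 3) :
    (independenceIdeal Δ (genericTable K a)).IsRadical := by
  by_cases ha : ∀ j, a j ≠ 0
  · have : ∀ j, NeZero (a j) := fun j => ⟨ha j⟩
    rw [independenceIdeal_eq_map_swapIdeal, swapIdeal_eq_swapIdeal_facets, ← Ideal.comap_symm]
    exact (swapIdeal_isRadical (swapTorsionFreeAt_of_ncard_le_three hfacets)).comap _
  -- An empty index range leaves no variables; all marginal entries are empty sums and the ideal is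
  -- zero.
  · push Not at ha
    obtain ⟨j, hj⟩ := ha
    have : IsEmpty ((j : Fin n) → Fin (a j)) := ⟨fun x => (Fin.cast hj (x j)).elim0⟩
    rw [independenceIdeal_eq_bot_of_isEmpty]
    exact Ideal.isPrime_bot.isRadical
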